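/- Let $G$ be an infinite group with a finite symmetric generating set $S$ and identity $e$, and let $1<p<\infty$ be real. Let $D_p(G)$ be the space of functions $f\colon G\to\mathbb{C}$ with $\sum_{g\in G}|f(gs^{-1})-f(g)|^p<\infty$ for all $s\in S$, with the norm $$\|f\|_{D_p}=\Bigl(\sum_{s\in S}\sum_{g\in G}|f(gs^{-1})-f(g)|^p+|f(e)|^p\Bigr)^{1/p}.$$ Let $\ell^p(G)\subseteq D_p(G)$ be the space of $p$-summable functions, let $\mathbb{C}\subseteq D_p(G)$ be the constant functions, and let $\mathbb{C}G\subseteq D_p(G)$ be the finitely supported functions. The first reduced $\ell^p$-cohomology of $G$ is $$\bar H^1_{(p)}(G)=D_p(G)\big/\overline{\ell^p(G)\oplus\mathbb{C}},$$ where the closure is taken in $D_p(G)$. Let $BD_p(G)$ be the algebra, under pointwise operations, of the bounded functions in $D_p(G)$; a character of $BD_p(G)$ is a nonzero $\mathbb{C}$-algebra homomorphism $BD_p(G)\to\mathbb{C}$. The $p$-harmonic boundary $\partial_p(G)$ is the set of all characters $x$ of $BD_p(G)$ that are not of the form $f\mapsto f(g)$ with $g\in G$ and that satisfy $x(f)=0$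 for every bounded function $f$ in the closure of $\mathbb{C}G$ in $D_p(G)$. Then $\bar H^1_{(p)}(G)\neq 0$ if and only if $\partial_p(G)$ has more than one element. -/

import Mathlib

noncomputable section

namespace PHarmonic

/-! ### Auxiliary facts on `p`-summable functions -/

theorem summable_rpow_add {α : Type*} {p : ℝ} (hp : 1 ≤ p) {u v : α → ℝ}
    (hu0 : ∀ a, 0 ≤ u a) (hv0 : ∀ a, 0 ≤ v a)
    (hu : Summable fun a => u a ^ p) (hv : Summable fun a => v a ^ p) :
    Summable fun a => (u a + v a) ^ p :=
  Real.summable_Lp_add_of_nonneg hp hu0 hv0 hu hv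

theorem summable_norm_rpow_of_le {α : Type*} {p : ℝ} (hp : 1 ≤ p) {u v : α → ℝ} {w : α → ℂ}
    (hu0 : ∀ a, 0 ≤ u a) (hv0 : ∀ a, 0 ≤ v a)
    (hu : Summable fun a => u a ^ p) (hv : Summable fun a => v a ^ p)
    (h : ∀ a, ‖w a‖ ≤ u a + v a) :
    Summable fun a => ‖w a‖ ^ p :=
  Summable.of_nonneg_of_le (fun _ => by positivity)
    (fun a => Real.rpow_le_rpow (norm_nonneg _) (h a) (by linarith))
    (summable_rpow_add hp hu0 hv0 hu hv)

theorem summable_const_mul_rpow {α : Type*} {p : ℝ} {c : ℝ} (hc : 0 ≤ c) {u : α → ℝ}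
    (hu0 : ∀ a, 0 ≤ u a) (hu : Summable fun a => u a ^ p) :
    Summable fun a => (c * u a) ^ p := by
  simpa only [Real.mul_rpow hc (hu0 _)] using hu.mul_left (c ^ p)

theorem rpow_add_rpow_le {p : ℝ} (hp : 1 ≤ p) {a b c d : ℝ}
    (ha : 0 ≤ a) (hb : 0 ≤ b) (hc : 0 ≤ c) (hd : 0 ≤ d) :
    ((a + b) ^ p + (c + d) ^ p) ^ (1 / p) ≤
      (a ^ p + c ^ p) ^ (1 / p) + (b ^ p + d ^ p) ^ (1 / p) := by
  have h := Real.Lp_add_le_of_nonneg (s := Finset.univ) (f := ![a, c]) (g := ![b, d]) hp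
    (by simp [Fin.forall_fin_two, ha, hc]) (by simp [Fin.forall_fin_two, hb, hd])
  simpa [Fin.sum_univ_two] using h

variable {G : Type*} [Group G]

/-! ### The space `D_p(G)` -/

/-- The functions `f : G → ℂ` with `∑_g |f(g s⁻¹) - f(g)|^p < ∞` for every `s ∈ S`. -/
def dirichletSubmodule (S : Finset G) (p : ℝ) [hp : Fact (1 ≤ p)] : Submodule ℂ (G → ℂ) where
  carrier := {f | ∀ s ∈ S, Summable fun g => ‖f (g * s⁻¹) - f g‖ ^ p}
  zero_mem' := fun s _ => by
    have : p ≠ 0 := by linarith [hp.out]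
    simp [Real.zero_rpow this]
  add_mem' := fun {f h} hf hh s hs =>
    summable_norm_rpow_of_le hp.out (fun _ => norm_nonneg _) (fun _ => norm_nonneg _)
      (hf s hs) (hh s hs) (fun g => by
        refine le_trans (le_of_eq ?_) (norm_add_le _ _)
        simp only [Pi.add_apply]
        congr 1
        ring)
  smul_mem' := fun c f hf s hs => by
    have := summable_const_mul_rpow (norm_nonneg c) (fun _ => norm_nonneg _) (hf s hs)
    simpa only [Pi.smul_apply, ← smul_sub, norm_smul] using this

/-- The space `D_p(G)`. It is a type of its own, so that it carries the topology of the norm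
below and not the topology of pointwise convergence. -/
def Dp (S : Finset G) (p : ℝ) [Fact (1 ≤ p)] : Type _ := dirichletSubmodule S p

namespace Dp

variable {S : Finset G} {p : ℝ} [hp : Fact (1 ≤ p)]

instance : AddCommGroup (Dp S p) := inferInstanceAs (AddCommGroup (dirichletSubmodule S p))

instance : Module ℂ (Dp S p) := inferInstanceAs (Module ℂ (dirichletSubmodule S p))

/-- The inclusion of `D_p(G)` in the space of all complex-valued functions on `G`. -/
def toFun : Dp S p →ₗ[ℂ] (G → ℂ) := (dirichletSubmodule S p).subtype

instance : CoeFun (Dp S p) (fun _ => G → ℂ) := ⟨fun f => toFun f⟩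

theorem summable (f : Dp S p) {s : G} (hs : s ∈ S) :
    Summable fun g => ‖f (g * s⁻¹) - f g‖ ^ p := f.2 s hs

/-- The pseudonorm `‖f‖ = (∑_{s ∈ S} ∑_g |f(g s⁻¹) - f(g)|^p)^{1/p}`. -/
def energy (f : Dp S p) : ℝ :=
  (∑ s ∈ S, ∑' g : G, ‖f (g * s⁻¹) - f g‖ ^ p) ^ (1 / p)

/-- The norm `‖f‖_{D_p} = (‖f‖^p + |f(e)|^p)^{1/p}`. -/
instance : Norm (Dp S p) := ⟨fun f => (energy f ^ p + ‖f 1‖ ^ p) ^ (1 / p)⟩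

theorem norm_def (f : Dp S p) : ‖f‖ = (energy f ^ p + ‖f 1‖ ^ p) ^ (1 / p) := rfl

theorem energy_nonneg (f : Dp S p) : 0 ≤ energy f := by
  unfold energy
  have : ∀ s ∈ S, 0 ≤ ∑' g : G, ‖f (g * s⁻¹) - f g‖ ^ p :=
    fun s _ => tsum_nonneg fun g => by positivity
  exact Real.rpow_nonneg (Finset.sum_nonneg this) _

theorem energy_smul (c : ℂ) (f : Dp S p) : energy (c • f) = ‖c‖ * energy f := by
  have hp0 : p ≠ 0 := by linarith [hp.out]
  have h0 : 0 ≤ ∑ s ∈ S, ∑' g : G, ‖f (g * s⁻¹) - f g‖ ^ p :=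
    Finset.sum_nonneg fun s _ => tsum_nonneg fun g => by positivity
  unfold energy
  simp only [map_smul, Pi.smul_apply, ← smul_sub, norm_smul,
    Real.mul_rpow (norm_nonneg _) (norm_nonneg _), tsum_mul_left, ← Finset.mul_sum]
  rw [Real.mul_rpow (by positivity) h0, ← Real.rpow_mul (norm_nonneg _), mul_one_div_cancel hp0,
    Real.rpow_one]

theorem energy_add_le (f h : Dp S p) : energy (f + h) ≤ energy f + energy h := by
  have hp1 := hp.out
  have hp0 : p ≠ 0 := by linarith
  have hpp : 0 ≤ p := by linarith
  have key : ∀ u : Dp S p, ∀ s : G, 0 ≤ ∑' g : G, ‖u (g * s⁻¹) - u g‖ ^ p :=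
    fun u s => tsum_nonneg fun g => by positivity
  have back : ∀ u : Dp S p, ∀ s : G, ((∑' g : G, ‖u (g * s⁻¹) - u g‖ ^ p) ^ (1 / p)) ^ p =
      ∑' g : G, ‖u (g * s⁻¹) - u g‖ ^ p := fun u s => by
    rw [← Real.rpow_mul (key u s), one_div_mul_cancel hp0, Real.rpow_one]
  have step : ∀ s ∈ S, ∑' g : G, ‖(f + h) (g * s⁻¹) - (f + h) g‖ ^ p ≤
      ((∑' g : G, ‖f (g * s⁻¹) - f g‖ ^ p) ^ (1 / p) +
        (∑' g : G, ‖h (g * s⁻¹) - h g‖ ^ p) ^ (1 / p)) ^ p := by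
    intro s hs
    have h1 := Real.Lp_add_le_tsum_of_nonneg' hp1 (fun g => norm_nonneg (f (g * s⁻¹) - f g))
      (fun g => norm_nonneg (h (g * s⁻¹) - h g)) (f.summable hs) (h.summable hs)
    have h2 : ∑' g : G, ‖(f + h) (g * s⁻¹) - (f + h) g‖ ^ p ≤
        ∑' g : G, (‖f (g * s⁻¹) - f g‖ + ‖h (g * s⁻¹) - h g‖) ^ p := by
      refine Summable.tsum_le_tsum (fun g => ?_) ((f + h).summable hs)
        (summable_rpow_add hp1 (fun g => norm_nonneg _) (fun g => norm_nonneg _)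
          (f.summable hs) (h.summable hs))
      refine Real.rpow_le_rpow (norm_nonneg _) ?_ hpp
      refine le_trans (le_of_eq ?_) (norm_add_le _ _)
      simp only [map_add, Pi.add_apply]
      congr 1
      ring
    refine h2.trans ?_
    have h3 : 0 ≤ ∑' g : G, (‖f (g * s⁻¹) - f g‖ + ‖h (g * s⁻¹) - h g‖) ^ p :=
      tsum_nonneg fun g => by positivity
    have h4 := Real.rpow_le_rpow (Real.rpow_nonneg h3 _) h1 hpp
    rwa [← Real.rpow_mul h3, one_div_mul_cancel hp0, Real.rpow_one] at h4
  have h5 := Real.Lp_add_le_of_nonneg (s := S)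
    (f := fun s => (∑' g : G, ‖f (g * s⁻¹) - f g‖ ^ p) ^ (1 / p))
    (g := fun s => (∑' g : G, ‖h (g * s⁻¹) - h g‖ ^ p) ^ (1 / p)) hp1
    (fun s _ => Real.rpow_nonneg (key f s) _) (fun s _ => Real.rpow_nonneg (key h s) _)
  simp only [back] at h5
  exact (Real.rpow_le_rpow (Finset.sum_nonneg fun s _ => key (f + h) s)
    (Finset.sum_le_sum step) (by positivity)).trans h5

theorem core : SeminormedSpace.Core ℂ (Dp S p) where
  norm_nonneg f := by
    have := energy_nonneg f
    rw [norm_def]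
    positivity
  norm_smul c f := by
    have hp0 : p ≠ 0 := by linarith [hp.out]
    have := energy_nonneg f
    rw [norm_def, norm_def, energy_smul, map_smul, Pi.smul_apply, norm_smul,
      Real.mul_rpow (norm_nonneg _) this, Real.mul_rpow (norm_nonneg _) (norm_nonneg _),
      ← mul_add, Real.mul_rpow (by positivity) (by positivity), ← Real.rpow_mul (norm_nonneg _),
      mul_one_div_cancel hp0, Real.rpow_one]
  norm_triangle f h := by
    have hp1 := hp.out
    have hpp : 0 ≤ p := by linarith
    have e1 := energy_nonneg f
    have e2 := energy_nonneg h
    have e3 := energy_nonneg (f + h)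
    rw [norm_def, norm_def, norm_def]
    refine le_trans ?_ (rpow_add_rpow_le hp1 e1 e2 (norm_nonneg (f 1)) (norm_nonneg (h 1)))
    refine Real.rpow_le_rpow (by positivity) (add_le_add ?_ ?_) (by positivity)
    · exact Real.rpow_le_rpow e3 (energy_add_le f h) hpp
    · rw [map_add, Pi.add_apply]
      exact Real.rpow_le_rpow (norm_nonneg _) (norm_add_le _ _) hpp

instance : SeminormedAddCommGroup (Dp S p) := SeminormedAddCommGroup.ofCore core

instance : NormedSpace ℂ (Dp S p) where
  norm_smul_le c f := (core.norm_smul c f).le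

end Dp

/-! ### The first reduced `ℓ^p`-cohomology -/

section Cohomology

variable (S : Finset G) (p : ℝ) [hp : Fact (1 ≤ p)]

/-- `ℓ^p(G)` as a subspace of `D_p(G)`. -/
def ellp : Submodule ℂ (Dp S p) where
  carrier := {f | Summable fun g => ‖f g‖ ^ p}
  zero_mem' := by
    have : p ≠ 0 := by linarith [hp.out]
    simp [Real.zero_rpow this]
  add_mem' := fun {f h} hf hh =>
    summable_norm_rpow_of_le hp.out (fun _ => norm_nonneg _) (fun _ => norm_nonneg _) hf hh
      (fun g => by simpa only [map_add, Pi.add_apply] using norm_add_le (f g) (h g))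
  smul_mem' := fun c f hf => by
    have := summable_const_mul_rpow (norm_nonneg c) (fun _ => norm_nonneg _) hf
    simpa only [Set.mem_ofPred_eq, map_smul, Pi.smul_apply, norm_smul] using this

/-- The constant functions as a subspace of `D_p(G)`. -/
def constants : Submodule ℂ (Dp S p) where
  carrier := {f | ∃ c : ℂ, ∀ g, f g = c}
  zero_mem' := ⟨0, fun g => by simp⟩
  add_mem' := fun ⟨c, hc⟩ ⟨d, hd⟩ => ⟨c + d, fun g => by simp [hc, hd]⟩
  smul_mem' := fun a _ ⟨c, hc⟩ => ⟨a * c, fun g => by simp [hc]⟩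

/-- The first reduced `ℓ^p`-cohomology space: the quotient of `D_p(G)` by the closure of
`ℓ^p(G) ⊕ ℂ` in `D_p(G)`. -/
abbrev ReducedCohomology : Type _ :=
  Dp S p ⧸ (ellp S p ⊔ constants S p).topologicalClosure

end Cohomology

/-! ### The algebra `BD_p(G)` and the `p`-harmonic boundary -/

section Boundary

variable (S : Finset G) (p : ℝ) [hp : Fact (1 ≤ p)]

/-- The algebra `BD_p(G)` of bounded functions in `D_p(G)`, with pointwise operations. -/
def BDp : Subalgebra ℂ (G → ℂ) where
  carrier := {f | f ∈ dirichletSubmodule S p ∧ ∃ C : ℝ, ∀ g, ‖f g‖ ≤ C}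
  add_mem' := fun {f h} ⟨hf, C, hC⟩ ⟨hh, D, hD⟩ =>
    ⟨add_mem hf hh, C + D, fun g => (norm_add_le _ _).trans (add_le_add (hC g) (hD g))⟩
  mul_mem' := fun {f h} ⟨hf, C, hC⟩ ⟨hh, D, hD⟩ => by
    have hC0 : 0 ≤ C := (norm_nonneg _).trans (hC 1)
    have hD0 : 0 ≤ D := (norm_nonneg _).trans (hD 1)
    refine ⟨fun s hs => ?_, C * D, fun g => ?_⟩
    · refine summable_norm_rpow_of_le hp.out
        (u := fun g => C * ‖h (g * s⁻¹) - h g‖) (v := fun g => D * ‖f (g * s⁻¹) - f g‖)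
        (fun _ => by positivity) (fun _ => by positivity)
        (summable_const_mul_rpow hC0 (fun _ => norm_nonneg _) (hh s hs))
        (summable_const_mul_rpow hD0 (fun _ => norm_nonneg _) (hf s hs)) (fun g => ?_)
      have e : (f * h) (g * s⁻¹) - (f * h) g =
          f (g * s⁻¹) * (h (g * s⁻¹) - h g) + h g * (f (g * s⁻¹) - f g) := by
        simp only [Pi.mul_apply]
        ring
      rw [e]
      refine (norm_add_le _ _).trans ?_
      rw [norm_mul, norm_mul]
      gcongr
      · exact hC _
      · exact hD _
    · rw [Pi.mul_apply, norm_mul]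
      exact mul_le_mul (hC g) (hD g) (norm_nonneg _) hC0
  algebraMap_mem' := fun c => by
    have : p ≠ 0 := by linarith [hp.out]
    refine ⟨fun s _ => ?_, ‖c‖, fun g => by simp⟩
    simp [Real.zero_rpow this]

variable {S p} in
/-- The inclusion of `BD_p(G)` in `D_p(G)`. -/
def BDp.toDp (f : BDp S p) : Dp S p := ⟨f.1, f.2.1⟩

/-- The characters of `BD_p(G)`: the nonzero algebra homomorphisms `BD_p(G) → ℂ`. -/
abbrev Spectrum : Type _ := {x : BDp S p →ₙₐ[ℂ] ℂ // x ≠ 0}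

/-- The map `i : G → Sp(BD_p(G))`, where `i(g)` is the evaluation at `g`. -/
def evalChar (g : G) : Spectrum S p :=
  ⟨{ toFun := fun f => (f : G → ℂ) g
     map_smul' := fun _ _ => rfl
     map_zero' := rfl
     map_add' := fun _ _ => rfl
     map_mul' := fun _ _ => rfl },
   fun h => one_ne_zero (α := ℂ) (DFunLike.congr_fun h (1 : BDp S p))⟩

/-- The set `ℂG` of functions with finite support, in `D_p(G)`. -/
def finSupp : Set (Dp S p) := {f | (Function.support f).Finite}

/-- The bounded functions in the closure of `ℂG` in `D_p(G)`. -/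
def boundedClosure : Set (BDp S p) := {f | BDp.toDp f ∈ closure (finSupp S p)}

/-- The `p`-harmonic boundary `∂_p(G)`: the characters of `BD_p(G)` that are not evaluations at
elements of `G` and vanish on the bounded functions in the closure of `ℂG`. -/
def harmonicBoundary : Set (Spectrum S p) :=
  {x | x ∉ Set.range (evalChar S p) ∧ ∀ f ∈ boundedClosure S p, x.1 f = 0}

end Boundary

end PHarmonic

end

/-! Let `I` be the set of bounded functions in the closure of `ℂG`. Truncating approximants shows
that `I` is an ideal of `BD_p(G)`. Let `ℱ` be the coarsest filter on `G` along which all functions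
of `I` tend to `0`. Limits along ultrafilters finer than `ℱ` are characters in `∂_p(G)`, so a
bounded function `f` killed by `∂_p(G)` tends to `0` along `ℱ`; hence for every `r > 0` some
`h ∈ I` is bounded away from `0` where `|f| ≥ r`. Such an `h` divides `f` minus its truncation at
height `r`, which therefore lies in `I`, and `r → 0` gives `f ∈ I`. So `I` is the common kernel of
the characters in `∂_p(G)`. Since the closure of `ℓ^p(G) ⊕ ℂ` is the closure of `ℂG` plus the
constants, a bounded function lies in it exactly when all points of `∂_p(G)` take the same value
on it; bounded functions being dense in `D_p(G)`, the closure is everything exactly when `∂_p(G)`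
has at most one point. -/

namespace PHarmonic

open Filter Topology
open scoped NNReal

section Summation

theorem tendsto_tsum_rpow_of_le_add {ι α : Type*} {l : Filter ι} {p : ℝ} (hp : 1 ≤ p)
    {a b : ι → α → ℝ} {c : α → ℝ} (ha : ∀ i x, 0 ≤ a i x) (hb : ∀ i x, 0 ≤ b i x)
    (hc : ∀ x, 0 ≤ c x) (hab : ∀ i x, a i x ≤ b i x + c x)
    (hb_summable : ∀ i, Summable fun x => b i x ^ p) (hc_summable : Summable fun x => c x ^ p)
    (ha_lim : ∀ x, Tendsto (fun i => a i x) l (𝓝 0))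
    (hb_lim : Tendsto (fun i => ∑' x, b i x ^ p) l (𝓝 0)) :
    Tendsto (fun i => ∑' x, a i x ^ p) l (𝓝 0) := by
  have hp0 : 0 < p := by linarith
  let m : ι → α → ℝ := fun i x => min (a i x) (c x)
  have hm : ∀ i x, 0 ≤ m i x := fun i x => le_min (ha i x) (hc x)
  have hm_le : ∀ i x, m i x ^ p ≤ c x ^ p := fun i x =>
    Real.rpow_le_rpow (hm i x) (min_le_right _ _) hp0.le
  have hm_summable : ∀ i, Summable fun x => m i x ^ p := fun i =>
    hc_summable.of_nonneg_of_le (fun x => Real.rpow_nonneg (hm i x) _) (hm_le i)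
  have hm_tendsto : ∀ x, Tendsto (fun i => m i x ^ p) l (𝓝 0) := fun x => by
    have h := (squeeze_zero (hm · x) (fun i => min_le_left _ _) (ha_lim x)).rpow_const
      (p := p) (Or.inr hp0.le)
    rwa [Real.zero_rpow hp0.ne'] at h
  have hm_lim : Tendsto (fun i => ∑' x, m i x ^ p) l (𝓝 0) := by
    simpa only [tsum_zero] using tendsto_tsum_of_dominated_convergence hc_summable hm_tendsto
      (Eventually.of_forall fun i x => by
        rw [Real.norm_of_nonneg (Real.rpow_nonneg (hm i x) _)]
        exact hm_le i x)
  have ha_le : ∀ i x, a i x ^ p ≤ 2 ^ (p - 1) * (b i x ^ p + m i x ^ p) := fun i x => by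
    have h : a i x ≤ b i x + m i x := by
      rw [← min_add_add_left]
      exact le_min (le_add_of_nonneg_left (hb i x)) (hab i x)
    refine (Real.rpow_le_rpow (ha i x) h hp0.le).trans ?_
    exact_mod_cast NNReal.rpow_add_le_mul_rpow_add_rpow ⟨b i x, hb i x⟩ ⟨m i x, hm i x⟩ hp
  have hlim : Tendsto (fun i => 2 ^ (p - 1) * (∑' x, b i x ^ p + ∑' x, m i x ^ p)) l (𝓝 0) := by
    simpa using (hb_lim.add hm_lim).const_mul (2 ^ (p - 1))
  refine squeeze_zero (fun i => tsum_nonneg fun x => Real.rpow_nonneg (ha i x) _) (fun i => ?_) hlim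
  have hsum := ((hb_summable i).add (hm_summable i)).mul_left (2 ^ (p - 1))
  rw [← (hb_summable i).tsum_add (hm_summable i), ← tsum_mul_left]
  exact (hsum.of_nonneg_of_le (fun x => Real.rpow_nonneg (ha i x) _) (ha_le i)).tsum_le_tsum
    (ha_le i) hsum

theorem summable_norm_rpow_of_finite_support {α E : Type*} [SeminormedAddCommGroup E] {p : ℝ}
    (hp : p ≠ 0) {f : α → E} (hf : (Function.support f).Finite) :
    Summable fun x => ‖f x‖ ^ p :=
  summable_of_hasFiniteSupport <| hf.subset <| Function.support_subset_iff'.2 fun x hx => by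
    rw [Function.notMem_support.1 hx, norm_zero, Real.zero_rpow hp]

end Summation

section Lipschitz

/-- Truncation of the real and imaginary parts of a complex number to `[-r, r]`. It makes functions
bounded without increasing their differences by more than a constant factor. -/
def clamp (r : ℝ≥0) (z : ℂ) : ℂ := ⟨max (min z.re r) (-r), max (min z.im r) (-r)⟩

theorem lipschitzWith_clamp (r : ℝ≥0) : LipschitzWith 2 (clamp r) := by
  have key (a b : ℝ) : |max (min a r) (-r) - max (min b r) (-r)| ≤ |a - b| :=
    (abs_max_sub_max_le_abs _ _ _).trans ((abs_min_sub_min_le_max _ _ _ _).trans (by simp))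
  refine LipschitzWith.of_dist_le_mul fun z w => ?_
  rw [dist_eq_norm, dist_eq_norm]
  calc ‖clamp r z - clamp r w‖
      ≤ |(clamp r z - clamp r w).re| + |(clamp r z - clamp r w).im| :=
        Complex.norm_le_abs_re_add_abs_im _
    _ ≤ |(z - w).re| + |(z - w).im| := add_le_add (key _ _) (key _ _)
    _ ≤ ‖z - w‖ + ‖z - w‖ := add_le_add (Complex.abs_re_le_norm _) (Complex.abs_im_le_norm _)
    _ = (2 : ℝ≥0) * ‖z - w‖ := (two_mul _).symm

theorem norm_clamp_le (r : ℝ≥0) (z : ℂ) : ‖clamp r z‖ ≤ 2 * r := by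
  have key (a : ℝ) : |max (min a r) (-r)| ≤ r :=
    abs_le.2 ⟨le_max_right _ _, max_le (min_le_right _ _) (neg_le_self r.2)⟩
  calc ‖clamp r z‖ ≤ |(clamp r z).re| + |(clamp r z).im| := Complex.norm_le_abs_re_add_abs_im _
    _ ≤ r + r := add_le_add (key _) (key _)
    _ = 2 * r := (two_mul _).symm

theorem clamp_of_norm_le {r : ℝ≥0} {z : ℂ} (hz : ‖z‖ ≤ r) : clamp r z = z := by
  have key {a : ℝ} (ha : |a| ≤ r) : max (min a r) (-r) = a := by
    rw [min_eq_left (abs_le.1 ha).2, max_eq_left (abs_le.1 ha).1]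
  exact Complex.ext (key ((Complex.abs_re_le_norm z).trans hz))
    (key ((Complex.abs_im_le_norm z).trans hz))

theorem tendsto_clamp_atTop (z : ℂ) : Tendsto (fun r => clamp r z) atTop (𝓝 z) :=
  tendsto_const_nhds.congr' <| (eventually_ge_atTop ‖z‖₊).mono fun _ hr =>
    (clamp_of_norm_le hr).symm

theorem tendsto_clamp_nhdsGT_zero (z : ℂ) : Tendsto (fun r => clamp r z) (𝓝[>] 0) (𝓝 0) := by
  refine tendsto_nhdsWithin_of_tendsto_nhds (squeeze_zero_norm (norm_clamp_le · z) ?_)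
  simpa using (NNReal.continuous_coe.tendsto 0).const_mul 2

theorem lipschitzWith_inv_max_norm {E : Type*} [SeminormedAddCommGroup E] {δ : ℝ≥0} (hδ : 0 < δ) :
    LipschitzWith (δ ^ 2)⁻¹ fun z : E => (max ‖z‖ δ)⁻¹ := by
  refine LipschitzWith.of_dist_le_mul fun z w => ?_
  have hz : 0 < max ‖z‖ δ := lt_max_of_lt_right hδ
  have hw : 0 < max ‖w‖ δ := lt_max_of_lt_right hδ
  have hnum : |max ‖w‖ δ - max ‖z‖ δ| ≤ dist z w := by
    rw [dist_comm, dist_eq_norm]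
    exact (abs_max_sub_max_le_abs _ _ _).trans (abs_norm_sub_norm_le w z)
  have hden : (δ : ℝ) ^ 2 ≤ max ‖z‖ δ * max ‖w‖ δ := by
    rw [sq]
    gcongr <;> exact le_max_right _ _
  rw [Real.dist_eq, inv_sub_inv hz.ne' hw.ne', abs_div, abs_of_pos (mul_pos hz hw), div_eq_inv_mul]
  push_cast
  gcongr

end Lipschitz

section VanishingFilter

variable {ι X E : Type*} [SeminormedAddCommGroup E]

/-- The coarsest filter on `X` along which every function of the family `h` tends to zero. -/
def vanishingFilter (h : ι → X → E) : Filter X := ⨅ i, comap (h i) (𝓝 0)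

theorem tendsto_vanishingFilter (h : ι → X → E) (i : ι) :
    Tendsto (h i) (vanishingFilter h) (𝓝 0) :=
  tendsto_iInf' i tendsto_comap

theorem comap_nhds_zero_le_of_sq_norm_le {f g : X → E} (h : ∀ x, ‖f x‖ ^ 2 ≤ ‖g x‖) :
    comap g (𝓝 0) ≤ comap f (𝓝 0) := by
  rw [← tendsto_iff_comap]
  have hg : Tendsto (fun x => √‖g x‖) (comap g (𝓝 0)) (𝓝 0) := by
    simpa using (tendsto_comap (f := g) (x := 𝓝 0)).norm.sqrt
  exact squeeze_zero_norm (fun x => Real.le_sqrt_of_sq_le (h x)) hg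

theorem exists_norm_lt_of_mem_vanishingFilter [Nonempty ι] {h : ι → X → E}
    (hsq : ∀ i j, ∃ k, ∀ x, ‖h i x‖ ^ 2 + ‖h j x‖ ^ 2 ≤ ‖h k x‖) {A : Set X}
    (hA : A ∈ vanishingFilter h) : ∃ i, ∃ δ > 0, ∀ x, ‖h i x‖ < δ → x ∈ A := by
  have hdir : Directed (· ≥ ·) fun i => comap (h i) (𝓝 0) := fun i j => by
    obtain ⟨k, hk⟩ := hsq i j
    exact ⟨k,
      comap_nhds_zero_le_of_sq_norm_le fun x => (le_add_of_nonneg_right (sq_nonneg _)).trans (hk x),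
      comap_nhds_zero_le_of_sq_norm_le fun x => (le_add_of_nonneg_left (sq_nonneg _)).trans (hk x)⟩
  obtain ⟨i, hi⟩ := (mem_iInf_of_directed hdir A).1 hA
  obtain ⟨δ, hδ, hball⟩ := (Metric.nhds_basis_ball.comap (h i)).mem_iff.1 hi
  exact ⟨i, δ, hδ, fun x hx => hball (mem_ball_zero_iff.2 hx)⟩

theorem exists_tendsto_ultrafilter_of_norm_le [ProperSpace E] (U : Ultrafilter X) {f : X → E}
    {C : ℝ} (hf : ∀ x, ‖f x‖ ≤ C) : ∃ z, Tendsto f U (𝓝 z) := by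
  obtain ⟨z, -, hz⟩ := (isCompact_closedBall (0 : E) C).ultrafilter_le_nhds' (U.map f)
    (Ultrafilter.mem_map.2 (univ_mem' fun x => mem_closedBall_zero_iff.2 (hf x)))
  exact ⟨z, hz⟩

end VanishingFilter

variable {G : Type*} [Group G] {S : Finset G} {p : ℝ} [hp : Fact (1 ≤ p)]

section Convergence

namespace Dp

theorem norm_rpow (f : Dp S p) :
    ‖f‖ ^ p = ∑ s ∈ S, ∑' g : G, ‖f (g * s⁻¹) - f g‖ ^ p + ‖f 1‖ ^ p := by
  have hp0 : p ≠ 0 := by linarith [hp.out]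
  have hsum : 0 ≤ ∑ s ∈ S, ∑' g : G, ‖f (g * s⁻¹) - f g‖ ^ p :=
    Finset.sum_nonneg fun s _ => tsum_nonneg fun g => by positivity
  have henergy := energy_nonneg f
  rw [norm_def, one_div, Real.rpow_inv_rpow (by positivity) hp0, energy, one_div,
    Real.rpow_inv_rpow hsum hp0]

theorem norm_apply_one_le (f : Dp S p) : ‖f 1‖ ≤ ‖f‖ := by
  have hp0 : 0 < p := by linarith [hp.out]
  rw [← Real.rpow_le_rpow_iff (norm_nonneg _) (norm_nonneg _) hp0, norm_rpow]
  exact le_add_of_nonneg_left (Finset.sum_nonneg fun s _ => tsum_nonneg fun g => by positivity)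

theorem tsum_rpow_le_norm_rpow (f : Dp S p) {s : G} (hs : s ∈ S) :
    ∑' g : G, ‖f (g * s⁻¹) - f g‖ ^ p ≤ ‖f‖ ^ p := by
  rw [norm_rpow]
  exact (Finset.single_le_sum (f := fun s => ∑' g : G, ‖f (g * s⁻¹) - f g‖ ^ p)
    (fun s _ => tsum_nonneg fun g => by positivity) hs).trans
      (le_add_of_nonneg_right (by positivity))

theorem norm_apply_sub_apply_le (f : Dp S p) {s : G} (hs : s ∈ S) (g : G) :
    ‖f (g * s⁻¹) - f g‖ ≤ ‖f‖ := by
  have hp0 : 0 < p := by linarith [hp.out]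
  rw [← Real.rpow_le_rpow_iff (norm_nonneg _) (norm_nonneg _) hp0]
  exact ((f.summable hs).le_tsum g fun _ _ => by positivity).trans (f.tsum_rpow_le_norm_rpow hs)

theorem continuous_apply_one : Continuous fun f : Dp S p => f 1 :=
  AddMonoidHomClass.continuous_of_bound (LinearMap.proj (R := ℂ) (φ := fun _ : G => ℂ) 1 ∘ₗ toFun)
    1 fun f => by simpa using f.norm_apply_one_le

theorem continuous_apply_sub_apply {s : G} (hs : s ∈ S) (g : G) :
    Continuous fun f : Dp S p => f (g * s⁻¹) - f g :=
  AddMonoidHomClass.continuous_of_bound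
    ((LinearMap.proj (R := ℂ) (φ := fun _ : G => ℂ) (g * s⁻¹) - LinearMap.proj g) ∘ₗ toFun)
    1 fun f => by simpa using f.norm_apply_sub_apply_le hs g

theorem continuous_apply (hgen : Subgroup.closure (S : Set G) = ⊤) (g : G) :
    Continuous fun f : Dp S p => f g := by
  have hg : g ∈ Subgroup.closure (S : Set G) := by simp [hgen]
  induction hg using Subgroup.closure_induction_right with
  | one => exact continuous_apply_one
  | mul_right x _ s hs ih => exact
      (ih.sub (continuous_apply_sub_apply hs (x * s))).congr fun f => by simp
  | mul_inv_cancel x _ s hs ih => exact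
      ((continuous_apply_sub_apply hs x).add ih).congr fun f => by simp

theorem tendsto_zero_of_tendsto_tsum {ι : Type*} {l : Filter ι} {f : ι → Dp S p}
    (hone : Tendsto (fun i => f i 1) l (𝓝 0))
    (hsum : ∀ s ∈ S, Tendsto (fun i => ∑' g : G, ‖f i (g * s⁻¹) - f i g‖ ^ p) l (𝓝 0)) :
    Tendsto f l (𝓝 0) := by
  have hp0 : 0 < p := by linarith [hp.out]
  have hpow : Tendsto (fun i => ‖f i‖ ^ p) l (𝓝 0) := by
    simpa only [norm_rpow, Finset.sum_const_zero, norm_zero, Real.zero_rpow hp0.ne', add_zero]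
      using (tendsto_finsetSum S hsum).add (hone.norm.rpow_const (p := p) (Or.inr hp0.le))
  have hroot := hpow.rpow_const (p := p⁻¹) (Or.inr (inv_nonneg.2 hp0.le))
  simp only [Real.rpow_rpow_inv (norm_nonneg _) hp0.ne',
    Real.zero_rpow (inv_ne_zero hp0.ne')] at hroot
  exact tendsto_zero_iff_norm_tendsto_zero.2 hroot

theorem tendsto_zero_of_dominated {ι : Type*} {l : Filter ι} {f u : ι → Dp S p} {C : ℝ}
    {c : G → G → ℝ} (hC : 0 ≤ C) (hc : ∀ s g, 0 ≤ c s g)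
    (hc_summable : ∀ s ∈ S, Summable fun g => c s g ^ p) (hu : Tendsto u l (𝓝 0))
    (hf : ∀ g, Tendsto (fun i => f i g) l (𝓝 0))
    (hle : ∀ i, ∀ s ∈ S, ∀ g,
      ‖f i (g * s⁻¹) - f i g‖ ≤ C * ‖u i (g * s⁻¹) - u i g‖ + c s g) :
    Tendsto f l (𝓝 0) := by
  have hp0 : 0 < p := by linarith [hp.out]
  refine tendsto_zero_of_tendsto_tsum (hf 1) fun s hs => ?_
  have hf_diff (g : G) : Tendsto (fun i => ‖f i (g * s⁻¹) - f i g‖) l (𝓝 0) := by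
    simpa using ((hf (g * s⁻¹)).sub (hf g)).norm
  have hu_pow : Tendsto (fun i => ‖u i‖ ^ p) l (𝓝 0) := by
    simpa [Real.zero_rpow hp0.ne'] using hu.norm.rpow_const (p := p) (Or.inr hp0.le)
  have hu_sum : Tendsto (fun i => ∑' g, (C * ‖u i (g * s⁻¹) - u i g‖) ^ p) l (𝓝 0) := by
    simp only [Real.mul_rpow hC (norm_nonneg _), tsum_mul_left]
    simpa using (squeeze_zero (fun i => tsum_nonneg fun g => by positivity)
      (fun i => (u i).tsum_rpow_le_norm_rpow hs) hu_pow).const_mul (C ^ p)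
  exact tendsto_tsum_rpow_of_le_add hp.out (fun _ _ => norm_nonneg _) (fun _ _ => by positivity)
    (hc s) (fun i => hle i s hs)
    (fun i => summable_const_mul_rpow hC (fun _ => norm_nonneg _) ((u i).summable hs))
    (hc_summable s hs) hf_diff hu_sum

end Dp

end Convergence

section Composition

variable {K : ℝ≥0}

theorem comp_mem_dirichletSubmodule {T : ℂ → ℂ} (hT : LipschitzWith K T) {f : G → ℂ}
    (hf : f ∈ dirichletSubmodule S p) : T ∘ f ∈ dirichletSubmodule S p := fun s hs =>
  (summable_const_mul_rpow K.2 (fun _ => norm_nonneg _) (hf s hs)).of_nonneg_of_le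
    (fun _ => by positivity)
    fun _ => Real.rpow_le_rpow (norm_nonneg _) (hT.norm_sub_le _ _) (by linarith [hp.out])

/-- Composition of a function in `D_p(G)` with a Lipschitz map. -/
def Dp.comp (T : ℂ → ℂ) (hT : LipschitzWith K T) (f : Dp S p) : Dp S p :=
  ⟨T ∘ f, comp_mem_dirichletSubmodule hT f.2⟩

@[simp]
theorem Dp.comp_apply (T : ℂ → ℂ) (hT : LipschitzWith K T) (f : Dp S p) (g : G) :
    f.comp T hT g = T (f g) := rfl

theorem Dp.tendsto_comp {ι : Type*} {l : Filter ι} {T : ι → ℂ → ℂ} {T₀ : ℂ → ℂ}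
    {f : ι → Dp S p} {f₀ : Dp S p} (hT : ∀ i, LipschitzWith K (T i)) (hT₀ : LipschitzWith K T₀)
    (hT_lim : ∀ z, Tendsto (fun i => T i z) l (𝓝 (T₀ z))) (hf : Tendsto f l (𝓝 f₀))
    (hf_apply : ∀ g, Tendsto (fun i => f i g) l (𝓝 (f₀ g))) :
    Tendsto (fun i => (f i).comp (T i) (hT i)) l (𝓝 (f₀.comp T₀ hT₀)) := by
  rw [← tendsto_sub_nhds_zero_iff] at hf ⊢
  refine tendsto_zero_of_dominated (c := fun s g => 2 * K * ‖f₀ (g * s⁻¹) - f₀ g‖) K.coe_nonneg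
    (fun _ _ => by positivity)
    (fun s hs => summable_const_mul_rpow (by positivity) (fun _ => norm_nonneg _)
      (f₀.summable hs)) hf (fun g => ?_) (fun i s _ g => ?_)
  · have hTf : Tendsto (fun i => T i (f i g) - T i (f₀ g)) l (𝓝 0) :=
      squeeze_zero_norm (fun i => (hT i).norm_sub_le _ _)
        (by simpa using ((tendsto_sub_nhds_zero_iff.2 (hf_apply g)).norm).const_mul (K : ℝ))
    simpa using hTf.add (tendsto_sub_nhds_zero_iff.2 (hT_lim (f₀ g)))
  · simp only [map_sub, Pi.sub_apply, comp_apply]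
    have hi := (hT i).norm_sub_le (f i (g * s⁻¹)) (f i g)
    have h₀ := hT₀.norm_sub_le (f₀ (g * s⁻¹)) (f₀ g)
    have htri : ‖f i (g * s⁻¹) - f i g‖ ≤
        ‖f i (g * s⁻¹) - f₀ (g * s⁻¹) - (f i g - f₀ g)‖ + ‖f₀ (g * s⁻¹) - f₀ g‖ := by
      rw [sub_sub_sub_comm]
      exact norm_le_norm_sub_add _ _
    rw [sub_sub_sub_comm]
    linarith [norm_sub_le (T i (f i (g * s⁻¹)) - T i (f i g)) (T₀ (f₀ (g * s⁻¹)) - T₀ (f₀ g)),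
      mul_le_mul_of_nonneg_left htri K.coe_nonneg]

@[simp]
theorem BDp.toDp_apply (f : BDp S p) (g : G) : BDp.toDp f g = (f : G → ℂ) g := rfl

/-- Composition of a function in `BD_p(G)` with a Lipschitz map. -/
def BDp.comp (T : ℂ → ℂ) (hT : LipschitzWith K T) (f : BDp S p) : BDp S p :=
  ⟨T ∘ f.1, comp_mem_dirichletSubmodule hT f.2.1, by
    obtain ⟨C, hC⟩ := f.2.2
    refine ⟨K * C + ‖T 0‖, fun g => (norm_le_norm_sub_add _ (T 0)).trans ?_⟩
    gcongr
    refine (hT.norm_sub_le _ _).trans ?_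
    rw [sub_zero]
    exact mul_le_mul_of_nonneg_left (hC g) K.2⟩

/-- The pointwise complex conjugate of a function in `BD_p(G)`. -/
def BDp.conj (f : BDp S p) : BDp S p :=
  BDp.comp (starRingEnd ℂ) Complex.isometry_conj.lipschitz f

/-- The truncation of a function in `D_p(G)` at height `r`, as an element of `BD_p(G)`. -/
def Dp.trunc (r : ℝ≥0) (f : Dp S p) : BDp S p :=
  ⟨clamp r ∘ f, comp_mem_dirichletSubmodule (lipschitzWith_clamp r) f.2, 2 * r,
    fun _ => norm_clamp_le r _⟩

theorem Dp.trunc_apply (r : ℝ≥0) (f : Dp S p) (g : G) :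
    (f.trunc r : G → ℂ) g = clamp r (f g) := rfl

theorem Dp.tendsto_trunc_atTop (f : Dp S p) :
    Tendsto (fun r => BDp.toDp (f.trunc r)) atTop (𝓝 f) :=
  tendsto_comp lipschitzWith_clamp (LipschitzWith.id.weaken one_le_two) tendsto_clamp_atTop
    tendsto_const_nhds fun _ => tendsto_const_nhds

theorem Dp.tendsto_trunc_nhdsGT_zero (f : Dp S p) :
    Tendsto (fun r => BDp.toDp (f.trunc r)) (𝓝[>] 0) (𝓝 0) :=
  tendsto_comp lipschitzWith_clamp (LipschitzWith.const' 0) tendsto_clamp_nhdsGT_zero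
    tendsto_const_nhds fun _ => tendsto_const_nhds

theorem Dp.tendsto_toDp_trunc {ι : Type*} {l : Filter ι} {v : ι → Dp S p} {u : BDp S p}
    {r : ℝ≥0} (hgen : Subgroup.closure (S : Set G) = ⊤) (hu : ∀ g, ‖u.1 g‖ ≤ r)
    (hv : Tendsto v l (𝓝 (BDp.toDp u))) :
    Tendsto (fun i => BDp.toDp ((v i).trunc r)) l (𝓝 (BDp.toDp u)) := by
  have hfix : (BDp.toDp u).comp (clamp r) (lipschitzWith_clamp r) = BDp.toDp u :=
    Subtype.ext (funext fun g => clamp_of_norm_le (hu g))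
  have hlim := tendsto_comp (fun _ => lipschitzWith_clamp r) (lipschitzWith_clamp r)
    (fun _ => tendsto_const_nhds) hv fun g => ((continuous_apply hgen g).tendsto _).comp hv
  rwa [hfix] at hlim

theorem BDp.denseRange_toDp : DenseRange (BDp.toDp : BDp S p → Dp S p) := fun f =>
  mem_closure_of_tendsto f.tendsto_trunc_atTop (Eventually.of_forall fun _ => ⟨_, rfl⟩)

theorem BDp.tendsto_toDp_mul_zero {ι : Type*} {l : Filter ι} {z : ι → BDp S p} {M : ℝ}
    (hgen : Subgroup.closure (S : Set G) = ⊤) (hM : ∀ i g, ‖(z i).1 g‖ ≤ M)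
    (hz : Tendsto (fun i => BDp.toDp (z i)) l (𝓝 0)) (f : BDp S p) :
    Tendsto (fun i => BDp.toDp (f * z i)) l (𝓝 0) := by
  obtain ⟨C, hC⟩ := f.2.2
  have hC0 : 0 ≤ C := (norm_nonneg _).trans (hC 1)
  refine Dp.tendsto_zero_of_dominated (c := fun s g => |M| * ‖f.1 (g * s⁻¹) - f.1 g‖) hC0
    (fun _ _ => by positivity)
    (fun s hs => summable_const_mul_rpow (abs_nonneg M) (fun _ => norm_nonneg _) (f.2.1 s hs))
    hz (fun g => ?_) (fun i s _ g => ?_)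
  · simpa using (((Dp.continuous_apply hgen g).tendsto _).comp hz).const_mul (f.1 g)
  · have hleibniz : BDp.toDp (f * z i) (g * s⁻¹) - BDp.toDp (f * z i) g =
        f.1 g * ((z i).1 (g * s⁻¹) - (z i).1 g) +
          (z i).1 (g * s⁻¹) * (f.1 (g * s⁻¹) - f.1 g) := by
      simp only [toDp_apply, MulMemClass.coe_mul, Pi.mul_apply]
      ring
    rw [hleibniz]
    refine (norm_add_le _ _).trans ?_
    rw [norm_mul, norm_mul]
    exact add_le_add (mul_le_mul_of_nonneg_right (hC g) (norm_nonneg _))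
      (mul_le_mul_of_nonneg_right ((hM i _).trans (le_abs_self M)) (norm_nonneg _))

theorem BDp.dvd_of_le_norm {h k : BDp S p} {δ : ℝ≥0} (hδ : 0 < δ)
    (hh : ∀ g, k.1 g ≠ 0 → δ ≤ ‖h.1 g‖) : h ∣ k := by
  let q : BDp S p := BDp.comp (fun z => ((max ‖z‖ δ)⁻¹ : ℝ))
    (Complex.isometry_ofReal.lipschitz.comp (lipschitzWith_inv_max_norm hδ)) h
  refine ⟨BDp.conj h * q ^ 2 * k, Subtype.ext (funext fun g => ?_)⟩
  change k.1 g = h.1 g * (starRingEnd ℂ (h.1 g) * (((max ‖h.1 g‖ δ)⁻¹ : ℝ) : ℂ) ^ 2 * k.1 g)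
  by_cases hk : k.1 g = 0
  · simp [hk]
  · have hpos : (‖h.1 g‖ : ℂ) ≠ 0 :=
      Complex.ofReal_ne_zero.2 ((NNReal.coe_pos.2 hδ).trans_le (hh g hk)).ne'
    rw [max_eq_left (hh g hk), ← mul_assoc, ← mul_assoc, Complex.mul_conj']
    push_cast
    field_simp

end Composition

section FiniteSupport

theorem mem_dirichletSubmodule_of_summable {f : G → ℂ} (hf : Summable fun g => ‖f g‖ ^ p) :
    f ∈ dirichletSubmodule S p := fun s _ =>
  summable_norm_rpow_of_le hp.out (fun _ => norm_nonneg _) (fun _ => norm_nonneg _)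
    (hf.comp_injective (mul_left_injective s⁻¹)) hf fun _ => norm_sub_le _ _

theorem mem_dirichletSubmodule_of_finite_support {f : G → ℂ} (hf : (Function.support f).Finite) :
    f ∈ dirichletSubmodule S p :=
  mem_dirichletSubmodule_of_summable
    (summable_norm_rpow_of_finite_support (by linarith [hp.out]) hf)

variable (S p) in
/-- The space `ℂG` of finitely supported functions, as a subspace of `D_p(G)`. -/
def finSuppSubmodule : Submodule ℂ (Dp S p) where
  carrier := finSupp S p
  zero_mem' := by simp [finSupp]
  add_mem' := fun {f h} hf hh => (hf.union hh).subset <| by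
    rw [map_add]
    exact Function.support_add (f : G → ℂ) h
  smul_mem' := fun c f hf => hf.subset <| by
    rw [map_smul]
    exact Function.support_const_smul_subset c (f : G → ℂ)

theorem finSuppSubmodule_le_ellp : finSuppSubmodule S p ≤ ellp S p := fun _ hf =>
  summable_norm_rpow_of_finite_support (by linarith [hp.out]) hf

theorem ellp_le_topologicalClosure_finSuppSubmodule :
    ellp S p ≤ (finSuppSubmodule S p).topologicalClosure := by
  intro f hf
  have hf_summable : Summable fun g => ‖f g‖ ^ p := hf
  have hfin (F : Finset G) : (Function.support ((F : Set G).indicator f)).Finite :=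
    F.finite_toSet.subset Set.support_indicator_subset
  let u : Finset G → Dp S p := fun F =>
    ⟨(F : Set G).indicator f, mem_dirichletSubmodule_of_finite_support (hfin F)⟩
  have hu (F : Finset G) (g : G) : u F g = (F : Set G).indicator f g := rfl
  have hnorm (F : Finset G) (g : G) : ‖(u F - f) g‖ ≤ ‖f g‖ := by
    by_cases hg : g ∈ (F : Set G) <;> simp [hu, hg]
  refine mem_closure_of_tendsto (f := u) (b := atTop) (tendsto_sub_nhds_zero_iff.1 ?_)
    (Eventually.of_forall hfin)
  refine Dp.tendsto_zero_of_dominated (u := 0) (c := fun s g => ‖f (g * s⁻¹)‖ + ‖f g‖) le_rfl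
    (fun _ _ => by positivity)
    (fun s _ => summable_rpow_add hp.out (fun _ => norm_nonneg _) (fun _ => norm_nonneg _)
      (hf_summable.comp_injective (mul_left_injective s⁻¹)) hf_summable)
    tendsto_const_nhds (fun g => ?_) (fun F s _ g => ?_)
  · refine tendsto_const_nhds.congr' ?_
    filter_upwards [eventually_ge_atTop {g}] with F hF
    simp [hu, Finset.singleton_subset_iff.1 hF]
  · rw [zero_mul, zero_add]
    exact (norm_sub_le _ _).trans (add_le_add (hnorm _ _) (hnorm _ _))

theorem constants_eq_span : constants S p = Submodule.span ℂ {BDp.toDp (1 : BDp S p)} := by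
  ext f
  rw [Submodule.mem_span_singleton]
  constructor
  · rintro ⟨c, hc⟩
    exact ⟨c, Subtype.ext (funext fun g => (mul_one c).trans (hc g).symm)⟩
  · rintro ⟨c, rfl⟩
    exact ⟨c, fun _ => mul_one c⟩

theorem topologicalClosure_ellp_sup_constants :
    (ellp S p ⊔ constants S p).topologicalClosure =
      (finSuppSubmodule S p).topologicalClosure ⊔ constants S p := by
  have hclosed : IsClosed (((finSuppSubmodule S p).topologicalClosure ⊔ constants S p :
      Submodule ℂ (Dp S p)) : Set (Dp S p)) := by
    rw [constants_eq_span]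
    exact Submodule.isClosed_sup_finiteDimensional _ _ (Submodule.isClosed_topologicalClosure _)
  refine le_antisymm (Submodule.topologicalClosure_minimal _
    (sup_le_sup_right ellp_le_topologicalClosure_finSuppSubmodule _) hclosed) (sup_le ?_ ?_)
  · exact Submodule.topologicalClosure_mono (finSuppSubmodule_le_ellp.trans le_sup_left)
  · exact le_sup_right.trans (Submodule.le_topologicalClosure _)

theorem toDp_mem_topologicalClosure_iff_exists_sub_mem {f : BDp S p} :
    BDp.toDp f ∈ (ellp S p ⊔ constants S p).topologicalClosure ↔
      ∃ c : ℂ, f - c • 1 ∈ boundedClosure S p := by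
  rw [topologicalClosure_ellp_sup_constants, constants_eq_span]
  simp only [Submodule.mem_sup, Submodule.mem_span_singleton]
  constructor
  · rintro ⟨u, hu, _, ⟨c, rfl⟩, huc⟩
    have hsub : BDp.toDp (f - c • 1) = u := (eq_sub_of_add_eq huc).symm
    exact ⟨c, Set.mem_ofPred_eq ▸ hsub ▸ hu⟩
  · rintro ⟨c, hc⟩
    exact ⟨_, hc, _, ⟨c, rfl⟩, sub_add_cancel (BDp.toDp f) (c • BDp.toDp 1)⟩

end FiniteSupport

section Ideal

theorem mul_mem_boundedClosure (hgen : Subgroup.closure (S : Set G) = ⊤) (f : BDp S p)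
    {u : BDp S p} (hu : u ∈ boundedClosure S p) : f * u ∈ boundedClosure S p := by
  obtain ⟨M, hM⟩ := u.2.2
  lift M to ℝ≥0 using (norm_nonneg _).trans (hM 1)
  obtain ⟨v, hv, hvu⟩ := mem_closure_iff_seq_limit.1 hu
  let w : ℕ → BDp S p := fun n => (v n).trunc M
  have hwu : Tendsto (fun n => BDp.toDp (w n - u)) atTop (𝓝 0) :=
    tendsto_sub_nhds_zero_iff.2 (Dp.tendsto_toDp_trunc hgen hM hvu)
  have hbound (n : ℕ) (g : G) : ‖(w n - u).1 g‖ ≤ 2 * M + M :=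
    (norm_sub_le _ _).trans (add_le_add (norm_clamp_le M _) (hM g))
  have hlim : Tendsto (fun n => BDp.toDp (f * w n)) atTop (𝓝 (BDp.toDp (f * u))) := by
    have h := BDp.tendsto_toDp_mul_zero hgen hbound hwu f
    simp only [mul_sub] at h
    exact tendsto_sub_nhds_zero_iff.1 h
  refine mem_closure_of_tendsto hlim (Eventually.of_forall fun n => (hv n).subset fun g hg => ?_)
  contrapose! hg
  have hvg : v n g = 0 := Function.notMem_support.1 hg
  have hclamp : clamp M 0 = 0 := clamp_of_norm_le (by simp)
  simp [w, Dp.trunc_apply, hvg, hclamp]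

/-- The bounded functions in the closure of `ℂG`, as an ideal of `BD_p(G)`. -/
def boundedClosureIdeal (hgen : Subgroup.closure (S : Set G) = ⊤) : Ideal (BDp S p) where
  carrier := boundedClosure S p
  zero_mem' := (finSuppSubmodule S p).topologicalClosure.zero_mem
  add_mem' := (finSuppSubmodule S p).topologicalClosure.add_mem
  smul_mem' := fun f _ hu => mul_mem_boundedClosure hgen f hu

variable (S p) in
/-- The indicator function of `{g}`, as an element of `BD_p(G)`. -/
noncomputable def pointMass (g : G) : BDp S p :=
  ⟨Set.indicator {g} 1, mem_dirichletSubmodule_of_finite_support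
    ((Set.finite_singleton g).subset Set.support_indicator_subset), 1, fun h =>
      (norm_indicator_le_norm_self _ _).trans (by simp)⟩

theorem pointMass_mem_boundedClosure (g : G) : pointMass S p g ∈ boundedClosure S p :=
  subset_closure ((Set.finite_singleton g).subset Set.support_indicator_subset)

theorem exists_mem_boundedClosure_sq_norm_add_sq_norm_le
    (hgen : Subgroup.closure (S : Set G) = ⊤) {h k : BDp S p} (hh : h ∈ boundedClosure S p)
    (hk : k ∈ boundedClosure S p) :
    ∃ m ∈ boundedClosure S p, ∀ g, ‖h.1 g‖ ^ 2 + ‖k.1 g‖ ^ 2 ≤ ‖m.1 g‖ := by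
  refine ⟨BDp.conj h * h + BDp.conj k * k, (boundedClosureIdeal hgen).add_mem
    (mul_mem_boundedClosure hgen _ hh) (mul_mem_boundedClosure hgen _ hk), fun g => ?_⟩
  have hval : (BDp.conj h * h + BDp.conj k * k).1 g = ((‖h.1 g‖ ^ 2 + ‖k.1 g‖ ^ 2 : ℝ) : ℂ) := by
    push_cast
    rw [← Complex.conj_mul', ← Complex.conj_mul']
    rfl
  rw [hval, Complex.norm_real]
  exact Real.le_norm_self _

end Ideal

section Characters

theorem Spectrum.map_one (x : Spectrum S p) : x.1 1 = 1 := by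
  have hidem : x.1 1 * x.1 1 = x.1 1 := by rw [← map_mul, mul_one]
  refine (mul_left_eq_self₀.1 hidem).resolve_right fun h0 => x.2 ?_
  ext f
  rw [← one_mul f, map_mul, h0, zero_mul, NonUnitalAlgHom.zero_apply]

theorem Spectrum.map_sub_smul_one_eq_zero_iff (x : Spectrum S p) {f : BDp S p} {c : ℂ} :
    x.1 (f - c • 1) = 0 ↔ x.1 f = c := by
  rw [map_sub, map_smul, x.map_one, smul_eq_mul, mul_one, sub_eq_zero]

theorem mem_harmonicBoundary_iff {x : Spectrum S p} :
    x ∈ harmonicBoundary S p ↔ ∀ f ∈ boundedClosure S p, x.1 f = 0 := by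
  refine ⟨fun h => h.2, fun h => ⟨?_, h⟩⟩
  rintro ⟨g, rfl⟩
  have hzero : (pointMass S p g).1 g = 0 := h _ (pointMass_mem_boundedClosure g)
  simp [pointMass] at hzero

theorem exists_spectrum_forall_tendsto (U : Ultrafilter G) :
    ∃ x : Spectrum S p, ∀ f : BDp S p, Tendsto f.1 U (𝓝 (x.1 f)) := by
  choose x hx using fun f : BDp S p =>
    exists_tendsto_ultrafilter_of_norm_le U f.2.2.choose_spec
  have hone : x 1 = 1 := tendsto_nhds_unique (hx 1) tendsto_const_nhds
  exact ⟨⟨{ toFun := x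
            map_smul' := fun c f => tendsto_nhds_unique (hx _) ((hx f).const_smul c)
            map_zero' := tendsto_nhds_unique (hx _) tendsto_const_nhds
            map_add' := fun f h => tendsto_nhds_unique (hx _) ((hx f).add (hx h))
            map_mul' := fun f h => tendsto_nhds_unique (hx _) ((hx f).mul (hx h)) },
    fun h => one_ne_zero (hone.symm.trans (DFunLike.congr_fun h (1 : BDp S p)))⟩, hx⟩

theorem tendsto_vanishingFilter_of_forall_harmonicBoundary {f : BDp S p}
    (hf : ∀ x ∈ harmonicBoundary S p, x.1 f = 0) :
    Tendsto f.1 (vanishingFilter fun h : boundedClosure S p => h.1.1) (𝓝 0) := by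
  refine (tendsto_iff_ultrafilter _ _ _).2 fun U hU => ?_
  obtain ⟨x, hx⟩ := exists_spectrum_forall_tendsto (S := S) (p := p) U
  have hx_mem : x ∈ harmonicBoundary S p := mem_harmonicBoundary_iff.2 fun h hh =>
    tendsto_nhds_unique (hx h) ((tendsto_vanishingFilter _ ⟨h, hh⟩).mono_left hU)
  exact hf x hx_mem ▸ hx f

theorem sub_trunc_mem_boundedClosure (hgen : Subgroup.closure (S : Set G) = ⊤) {f : BDp S p}
    (hf : Tendsto f.1 (vanishingFilter fun h : boundedClosure S p => h.1.1) (𝓝 0))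
    {r : ℝ≥0} (hr : 0 < r) : f - (BDp.toDp f).trunc r ∈ boundedClosure S p := by
  have : Nonempty (boundedClosure S p) := ⟨0, (boundedClosureIdeal hgen).zero_mem⟩
  have hsmall : {g | ‖f.1 g‖ < r} ∈ vanishingFilter fun h : boundedClosure S p => h.1.1 :=
    hf.norm.eventually_lt_const (by simpa using hr)
  obtain ⟨⟨h, hh⟩, δ, hδ, hδf⟩ := exists_norm_lt_of_mem_vanishingFilter (fun h k => by
    simpa using exists_mem_boundedClosure_sq_norm_add_sq_norm_le hgen h.2 k.2) hsmall
  lift δ to ℝ≥0 using hδ.le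
  refine (boundedClosureIdeal hgen).mem_of_dvd (BDp.dvd_of_le_norm hδ fun g hg => ?_) hh
  contrapose! hg
  exact sub_eq_zero.2 (clamp_of_norm_le (hδf g hg).le).symm

theorem mem_boundedClosure_iff_forall_harmonicBoundary (hgen : Subgroup.closure (S : Set G) = ⊤)
    {f : BDp S p} : f ∈ boundedClosure S p ↔ ∀ x ∈ harmonicBoundary S p, x.1 f = 0 := by
  refine ⟨fun hf x hx => hx.2 f hf, fun hf => ?_⟩
  have hlim : Tendsto (fun r => BDp.toDp (f - (BDp.toDp f).trunc r)) (𝓝[>] 0)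
      (𝓝 (BDp.toDp f)) := by
    have h := (tendsto_const_nhds (x := BDp.toDp f)).sub (BDp.toDp f).tendsto_trunc_nhdsGT_zero
    rwa [sub_zero] at h
  exact isClosed_closure.mem_of_tendsto hlim <| eventually_nhdsWithin_of_forall fun _ hr =>
    sub_trunc_mem_boundedClosure hgen (tendsto_vanishingFilter_of_forall_harmonicBoundary hf) hr

theorem subsingleton_iff_forall_exists_eq {X : Set (Spectrum S p)} :
    X.Subsingleton ↔ ∀ f : BDp S p, ∃ c : ℂ, ∀ x ∈ X, x.1 f = c := by
  constructor
  · intro hX f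
    rcases hX.eq_empty_or_singleton with rfl | ⟨x, rfl⟩
    · exact ⟨0, by simp⟩
    · exact ⟨x.1 f, by simp⟩
  · intro h x hx y hy
    refine Subtype.ext (NonUnitalAlgHom.ext fun f => ?_)
    obtain ⟨c, hc⟩ := h f
    rw [hc x hx, hc y hy]

end Characters

theorem toDp_mem_topologicalClosure_iff_exists_eq (hgen : Subgroup.closure (S : Set G) = ⊤)
    {f : BDp S p} :
    BDp.toDp f ∈ (ellp S p ⊔ constants S p).topologicalClosure ↔
      ∃ c : ℂ, ∀ x ∈ harmonicBoundary S p, x.1 f = c := by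
  simp only [toDp_mem_topologicalClosure_iff_exists_sub_mem,
    mem_boundedClosure_iff_forall_harmonicBoundary hgen, Spectrum.map_sub_smul_one_eq_zero_iff]

theorem eq_top_iff_forall_toDp_mem {W : Submodule ℂ (Dp S p)} (hW : IsClosed (W : Set (Dp S p))) :
    W = ⊤ ↔ ∀ f : BDp S p, BDp.toDp f ∈ W :=
  ⟨fun h _ => h ▸ Submodule.mem_top, fun h => (Submodule.eq_top_iff').2 fun f =>
    BDp.denseRange_toDp.induction_on f hW h⟩

end PHarmonic

theorem theorem2p2_general {G : Type*} [Group G] (S : Finset G)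
    (hgen : Subgroup.closure (S : Set G) = ⊤) (p : ℝ) [Fact (1 ≤ p)] :
    Nontrivial (PHarmonic.ReducedCohomology S p) ↔
      1 < (PHarmonic.harmonicBoundary S p).encard := by
  rw [Submodule.Quotient.nontrivial_iff, Set.one_lt_encard_iff_nontrivial,
    ← Set.not_subsingleton_iff, not_iff_not,
    PHarmonic.eq_top_iff_forall_toDp_mem (Submodule.isClosed_topologicalClosure _),
    PHarmonic.subsingleton_iff_forall_exists_eq]
  exact forall_congr' fun f => PHarmonic.toDp_mem_topologicalClosure_iff_exists_eq hgen

theorem theorem2p2 {G : Type*} [Group G] [Infinite G] (S : Finset G)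
    (hsymm : ∀ s ∈ S, s⁻¹ ∈ S) (hgen : Subgroup.closure (S : Set G) = ⊤)
    (p : ℝ) [Fact (1 ≤ p)] (hp : 1 < p) :
    Nontrivial (PHarmonic.ReducedCohomology S p) ↔
      1 < (PHarmonic.harmonicBoundary S p).encard :=
  theorem2p2_general S hgen p
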